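/- Let $\omega=(\omega_n)_{n\in\mathbb{N}}$ be a frequency, that is, a strictly increasing sequence of non-negative real numbers with $\omega_n\to\infty$, and let $J\subset\mathbb{N}$ be a finite set. Let $\mathcal{H}_\infty^J(\omega)$ be the complex Banach space of all Dirichlet polynomials $D(s)=\sum_{n\in J}a_n e^{-\omega_n s}$ $(s\in\mathbb{C},\ a_n\in\mathbb{C})$ with the norm $\|D\|_\infty=\sup_{t\in\mathbb{R}}|D(it)|=\sup_{t\in\mathbb{R}}\big|\sum_{n\in J}a_ne^{-i\omega_n t}\big|$. For a closed subspace $Z$ of a complex Banach space $Y$ put $\boldsymbol{\lambda}(Z,Y)=\inf\|P\|$, the infimum over all bounded linear $P\colon Y\to Z$ with $P|_Z=\mathrm{id}_Z$ (and $\inf\emptyset=\infty$). For a complex Banach space $X$ let the projection constant $\boldsymbol{\lambda}(X)=\sup\boldsymbol{\lambda}(I(X),Y)$, the supremum over all complex Banach spaces $Y$ and all linear isometric embeddings $I\colon X\to Y$ such that $I(X)$ is complemented in $Y$. Let $(G,\beta)$ be an $\omega$-Dirichlet group, that is, $G$ is a compact abelian group, $\beta\colon\mathbb{R}\to G$ is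 a continuous homomorphism with dense range, and for every $n\in\mathbb{N}$ there is a (necessarily unique) continuous character $h_{\omega_n}\colon G\to\mathbb{T}$ with $h_{\omega_n}(\beta(t))=e^{-i\omega_n t}$ for all $t\in\mathbb{R}$. Let $\mathrm{m}$ be the normalized Haar measure of $G$. Then $$\boldsymbol{\lambda}\big(\mathcal{H}_\infty^{J}(\omega)\big)=\int_G\Big|\sum_{n\in J}h_{\omega_n}\Big|\,d\mathrm{m}.$$ -/

import Mathlib

open MeasureTheory Filter
open scoped ENNReal

universe u v

noncomputable section

/-- A frequency: a strictly increasing sequence of non-negative reals tending to infinity. -/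
structure IsFrequency (ω : ℕ → ℝ) : Prop where
  strictMono : StrictMono ω
  nonneg : ∀ n, 0 ≤ ω n
  tendsto : Tendsto ω atTop atTop

/-! ### Projection constants of complex Banach spaces -/

/-- The relative projection constant of a subspace `X` of `Y`: the infimum of the norms of the
bounded linear projections of `Y` onto `X` (and `∞` if there are none). -/
def relProjectionConstant {Y : Type*} [NormedAddCommGroup Y] [NormedSpace ℂ Y]
    (X : Submodule ℂ Y) : ℝ≥0∞ :=
  ⨅ (P : Y →L[ℂ] X) (_ : ∀ x : X, P (x : Y) = x), ENNReal.ofReal ‖P‖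

/-- The (absolute) projection constant of `X`: the supremum of the relative projection constants of
`I(X)` in `Y`, over all Banach spaces `Y` and all linear isometric embeddings `I : X → Y` such that
`I(X)` is complemented in `Y`. -/
def projectionConstant (X : Type u) [NormedAddCommGroup X] [NormedSpace ℂ X] : ℝ≥0∞ :=
  ⨆ (Y : Type v) (_ : NormedAddCommGroup Y) (_ : NormedSpace ℂ Y) (_ : CompleteSpace Y)
    (I : X →ₗᵢ[ℂ] Y) (_ : (LinearMap.range I.toLinearMap).ClosedComplemented),
    relProjectionConstant (LinearMap.range I.toLinearMap)

/-! ### Dirichlet polynomials -/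

/-- The complex vector space of all `ω`-Dirichlet polynomials
`D(s) = ∑_{n ∈ J} a_n e^{-ω_n s}` supported on `J`, as functions of `s ∈ ℂ`. -/
def dirichletPolynomials (ω : ℕ → ℝ) (J : Finset ℕ) : Submodule ℂ (ℂ → ℂ) where
  carrier := {D | ∃ a : ℕ → ℂ, ∀ s, D s = ∑ n ∈ J, a n * Complex.exp (-(ω n : ℂ) * s)}
  zero_mem' := ⟨0, fun s => by simp⟩
  add_mem' := by
    rintro D E ⟨a, ha⟩ ⟨b, hb⟩
    exact ⟨a + b, fun s => by simp [ha, hb, add_mul, Finset.sum_add_distrib]⟩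
  smul_mem' := by
    rintro c D ⟨a, ha⟩
    exact ⟨c • a, fun s => by simp [ha, Finset.mul_sum, mul_assoc]⟩

/-- The space `H_∞^J(ω)`: the Dirichlet polynomials supported on `J`. It is a type of its own, so
that its only topology is the one of the supremum norm on the imaginary line, defined below. -/
def HInf (ω : ℕ → ℝ) (J : Finset ℕ) : Type := ↥(dirichletPolynomials ω J)

namespace HInf

variable {ω : ℕ → ℝ} {J : Finset ℕ}

instance : AddCommGroup (HInf ω J) := inferInstanceAs (AddCommGroup ↥(dirichletPolynomials ω J))

instance : Module ℂ (HInf ω J) := inferInstanceAs (Module ℂ ↥(dirichletPolynomials ω J))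

/-- The function `s ↦ D(s)`. -/
def toFun (D : HInf ω J) : ℂ → ℂ := D.1

/-- The norm `‖D‖ = sup_{t ∈ ℝ} |D(it)|`. -/
instance : Norm (HInf ω J) := ⟨fun D => ⨆ t : ℝ, ‖D.toFun (t * Complex.I)‖⟩

theorem norm_def (D : HInf ω J) : ‖D‖ = ⨆ t : ℝ, ‖D.toFun (t * Complex.I)‖ := rfl

theorem toFun_add (D E : HInf ω J) (s : ℂ) : (D + E).toFun s = D.toFun s + E.toFun s := rfl

theorem toFun_smul (c : ℂ) (D : HInf ω J) (s : ℂ) : (c • D).toFun s = c * D.toFun s := rfl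

theorem bddAbove (D : HInf ω J) :
    BddAbove (Set.range fun t : ℝ => ‖D.toFun (t * Complex.I)‖) := by
  obtain ⟨a, ha⟩ := D.2
  refine ⟨∑ n ∈ J, ‖a n‖, ?_⟩
  rintro _ ⟨t, rfl⟩
  change ‖D.1 _‖ ≤ _
  rw [ha]
  refine (norm_sum_le _ _).trans (Finset.sum_le_sum fun n _ => ?_)
  rw [norm_mul, Complex.norm_exp]
  simp

theorem norm_toFun_le (D : HInf ω J) (t : ℝ) : ‖D.toFun (t * Complex.I)‖ ≤ ‖D‖ :=
  le_ciSup D.bddAbove t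

theorem eq_zero_of_imaginary (D : HInf ω J) (h : ∀ t : ℝ, D.toFun (t * Complex.I) = 0) :
    D = 0 := by
  obtain ⟨a, ha⟩ := D.2
  have hd : Differentiable ℂ D.toFun := by
    have : D.toFun = fun s => ∑ n ∈ J, a n * Complex.exp (-(ω n : ℂ) * s) := funext ha
    rw [this]
    fun_prop
  have hcont : ContinuousAt (fun t : ℝ => (t : ℂ) * Complex.I) 0 := by fun_prop
  have htend : Tendsto (fun t : ℝ => (t : ℂ) * Complex.I) (nhdsWithin 0 {0}ᶜ)
      (nhdsWithin (0 : ℂ) {0}ᶜ) := by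
    refine tendsto_nhdsWithin_iff.2 ⟨?_, ?_⟩
    · have := hcont.tendsto.mono_left (nhdsWithin_le_nhds (s := ({0}ᶜ : Set ℝ)))
      simpa using this
    · filter_upwards [self_mem_nhdsWithin] with t ht
      simpa using ht
  have hfreq : ∃ᶠ z in nhdsWithin (0 : ℂ) {0}ᶜ, D.toFun z = 0 :=
    htend.frequently (Eventually.of_forall h).frequently
  have hzero : D.toFun = 0 := by
    have hD : AnalyticOnNhd ℂ D.toFun Set.univ := fun z _ => hd.analyticAt z
    have h0 : AnalyticOnNhd ℂ (0 : ℂ → ℂ) Set.univ := fun z _ => analyticAt_const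
    exact hD.eq_of_frequently_eq h0 hfreq
  exact Subtype.ext hzero

theorem normCore : NormedSpace.Core ℂ (HInf ω J) where
  norm_nonneg D := Real.iSup_nonneg fun _ => norm_nonneg _
  norm_smul c D := by
    simp only [norm_def, toFun_smul, norm_mul]
    exact (Real.mul_iSup_of_nonneg (norm_nonneg c) _).symm
  norm_triangle D E := by
    refine ciSup_le fun t => ?_
    rw [toFun_add]
    exact (norm_add_le _ _).trans (add_le_add (D.norm_toFun_le t) (E.norm_toFun_le t))
  norm_eq_zero_iff D := by
    constructor
    · intro h
      refine D.eq_zero_of_imaginary fun t => norm_le_zero_iff.1 ?_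
      exact (D.norm_toFun_le t).trans h.le
    · rintro rfl
      have h0 : ∀ s, (0 : HInf ω J).toFun s = 0 := fun _ => rfl
      simp [norm_def, h0]

instance : NormedAddCommGroup (HInf ω J) := NormedAddCommGroup.ofCore normCore

instance : NormedSpace ℂ (HInf ω J) := NormedSpace.ofCore normCore

end HInf

/-! ### Dirichlet groups -/

/-- `(G, β)` is a Dirichlet group: `β` is a continuous homomorphism from the additive group `ℝ`
into the (compact abelian) group `G`, with dense range. -/
def IsDirichletGroup {G : Type*} [CommGroup G] [TopologicalSpace G]
    (β : Multiplicative ℝ →ₜ* G) : Prop :=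
  DenseRange β

/-- The character `γ` of `G` satisfies `γ ∘ β = e^{-ix·}`. -/
def IsCharacterOver {G : Type*} [CommGroup G] [TopologicalSpace G]
    (β : Multiplicative ℝ →ₜ* G) (x : ℝ) (γ : PontryaginDual G) : Prop :=
  ∀ t : ℝ, γ (β (Multiplicative.ofAdd t)) = Circle.exp (-(x * t))

/-- `(G, β)` is an `ω`-Dirichlet group: a Dirichlet group such that for every `n` there is a
character `h` of `G` with `h ∘ β = e^{-i ω_n ·}`. -/
structure IsOmegaDirichletGroup {G : Type*} [CommGroup G] [TopologicalSpace G]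
    (ω : ℕ → ℝ) (β : Multiplicative ℝ →ₜ* G) : Prop where
  isDirichletGroup : IsDirichletGroup β
  exists_character : ∀ n, ∃ γ : PontryaginDual G, IsCharacterOver β (ω n) γ

end

open scoped ComplexConjugate BoundedContinuousFunction

/-! The Bohr lift `bohrLiftIsometry` identifies the Dirichlet polynomials isometrically with the
span of finitely many distinct characters `χ i` in `C(G, ℂ)`. Put `K = ∑ i, χ i`.

Upper bound (`exists_projection_norm_le`): for any isometric embedding into `Y`, Hahn–Banach extends
the sum of Fourier coefficients from families in `X` to families in `Y`, dominated by the `L¹` norm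
of `∑ i, conj (χ i) ⊗ y i`. On families with one nonzero entry the extension yields the coefficients
of a projection of norm at most `∫ ‖K‖`.

Lower bound (`integral_norm_sum_character_le`): averaging a projection of `C(G, ℂ)` over
translations gives convolution with `K` without increasing the norm. Its value at the identity is a
functional with kernel `conj K`, and testing it on approximate phases of `K` gives `∫ ‖K‖ ≤ ‖P‖`. -/

theorem integrable_of_continuous {S E : Type*} [TopologicalSpace S] [CompactSpace S]
    [MeasurableSpace S] [BorelSpace S] {m : Measure S} [IsFiniteMeasure m]
    [NormedAddCommGroup E] {f : S → E} (hf : Continuous f) : Integrable f m :=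
  hf.integrable_of_hasCompactSupport (HasCompactSupport.of_compactSpace f)

/-! ### Characters and their orthogonality -/

section Characters

variable {G : Type u} [CommGroup G] [TopologicalSpace G]

/-- A character of `G` as a continuous complex-valued function. -/
noncomputable def characterMap (χ : PontryaginDual G) : C(G, ℂ) := ⟨fun g => (χ g : ℂ), by fun_prop⟩

@[simp]
theorem characterMap_apply (χ : PontryaginDual G) (g : G) : characterMap χ g = (χ g : ℂ) := rfl

theorem conj_character (χ : PontryaginDual G) (g : G) : conj (χ g : ℂ) = ((χ g⁻¹ : Circle) : ℂ) := by
  rw [map_inv, Circle.coe_inv_eq_conj]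

theorem norm_sum_conj_character_mul {ι : Type*} [Fintype ι] (χ : ι → PontryaginDual G) (g g' : G) :
    ‖∑ i, conj (χ i g' : ℂ) * (χ i g : ℂ)‖ = ‖∑ i, (χ i (g⁻¹ * g') : ℂ)‖ := by
  rw [← Complex.norm_conj, map_sum]
  congr 1
  refine Finset.sum_congr rfl fun i _ => ?_
  rw [map_mul, Complex.conj_conj, conj_character, map_mul, Circle.coe_mul, mul_comm]

variable [IsTopologicalGroup G] [MeasurableSpace G] [BorelSpace G]
  {m : Measure G} [m.IsMulLeftInvariant]

/-- Translating by some `a` with `χ a ≠ 1` multiplies the invariant integral by `χ a`. -/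
theorem integral_character_of_ne_one {χ : PontryaginDual G} (hχ : χ ≠ 1) :
    ∫ g, (χ g : ℂ) ∂m = 0 := by
  obtain ⟨a, ha⟩ : ∃ a, χ a ≠ 1 := by
    by_contra! h
    exact hχ (PontryaginDual.ext h)
  have h1 : ∫ g, (χ (a * g) : ℂ) ∂m = ∫ g, (χ g : ℂ) ∂m :=
    integral_mul_left_eq_self (fun g => (χ g : ℂ)) a
  simp only [map_mul, Circle.coe_mul, integral_const_mul] at h1
  by_contra h0
  exact ha (Circle.ext (by simpa using mul_right_cancel₀ h0 (h1.trans (one_mul _).symm)))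

variable [IsProbabilityMeasure m]

theorem integral_conj_character_mul [DecidableEq (PontryaginDual G)] (χ ψ : PontryaginDual G) :
    ∫ g, conj (χ g : ℂ) * (ψ g : ℂ) ∂m = if χ = ψ then 1 else 0 := by
  have h : ∀ g, conj (χ g : ℂ) * (ψ g : ℂ) = (((χ⁻¹ * ψ : PontryaginDual G) g : Circle) : ℂ) := by
    intro g
    rw [← Circle.coe_inv_eq_conj, ← Circle.coe_mul]
    rfl
  simp only [h]
  split_ifs with hc
  · subst hc
    simp
  · exact integral_character_of_ne_one fun h1 => hc (inv_mul_eq_one.1 h1)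

variable [CompactSpace G]

/-- If a linear isometry `A` maps `e i` to the character `χ i` and the `e i` span `X`, then the
coordinates are the Fourier coefficients. -/
theorem sum_integral_smul_eq {ι : Type*} [Fintype ι] {χ : ι → PontryaginDual G}
    (hχ : Function.Injective χ) {X : Type*} [NormedAddCommGroup X] [NormedSpace ℂ X]
    (A : X →ₗᵢ[ℂ] C(G, ℂ)) (e : ι → X) (he : ∀ i, A (e i) = characterMap (χ i))
    (hspan : ∀ x, ∃ a : ι → ℂ, x = ∑ i, a i • e i) (x : X) :
    ∑ i, (∫ g, conj (χ i g : ℂ) * A x g ∂m) • e i = x := by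
  classical
  obtain ⟨a, rfl⟩ := hspan x
  refine Finset.sum_congr rfl fun i _ => ?_
  congr 1
  simp only [map_sum, map_smul, he, ContinuousMap.sum_apply, ContinuousMap.smul_apply,
    characterMap_apply, smul_eq_mul, Finset.mul_sum]
  rw [integral_finsetSum _ fun j _ => integrable_of_continuous (by fun_prop)]
  have : ∀ j, ∫ g, conj (χ i g : ℂ) * (a j * (χ j g : ℂ)) ∂m = if i = j then a j else 0 := by
    intro j
    simp only [mul_left_comm _ (a j), integral_const_mul, integral_conj_character_mul,
      hχ.eq_iff, mul_ite, mul_one, mul_zero]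
  simp [this]

end Characters

/-! ### Translations on `C(G, ℂ)` -/

section Translations

variable {G : Type u} [CommGroup G] [TopologicalSpace G] [IsTopologicalGroup G]

/-- The continuous map sending `g` to the translateMap `x ↦ f (x * g)`. -/
noncomputable def translateMap (f : C(G, ℂ)) : C(G, C(G, ℂ)) :=
  ContinuousMap.curry ⟨fun p : G × G => f (p.2 * p.1), by fun_prop⟩

@[simp]
theorem translateMap_apply (f : C(G, ℂ)) (g x : G) : translateMap f g x = f (x * g) := rfl

variable [CompactSpace G]

theorem norm_translateMap_le (f : C(G, ℂ)) (g : G) : ‖translateMap f g‖ ≤ ‖f‖ :=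
  (ContinuousMap.norm_le _ (norm_nonneg f)).2 fun x => f.norm_coe_le_norm (x * g)

end Translations

/-! ### Projections onto spans of characters -/

section Projections

variable {G : Type u} [CommGroup G] [TopologicalSpace G] [CompactSpace G]
  [MeasurableSpace G] [BorelSpace G]

/-- The Fourier coefficient with respect to `χ`, as a bounded functional on `C(G, ℂ)`. -/
noncomputable def fourierFunctional (m : Measure G) [IsProbabilityMeasure m]
    (χ : PontryaginDual G) : C(G, ℂ) →L[ℂ] ℂ :=
  LinearMap.mkContinuous
    { toFun f := ∫ g, conj (χ g : ℂ) * f g ∂m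
      map_add' f f' := by
        rw [← integral_add (integrable_of_continuous (by fun_prop))
          (integrable_of_continuous (by fun_prop))]
        simp [mul_add]
      map_smul' c f := by
        simp [mul_left_comm _ c, integral_const_mul] } 1 fun f => by
    refine (norm_integral_le_of_norm_le_const (C := ‖f‖) (Eventually.of_forall fun g => ?_)).trans
      (by simp)
    simpa [Circle.norm_coe] using f.norm_coe_le_norm g

theorem fourierFunctional_apply (m : Measure G) [IsProbabilityMeasure m]
    (χ : PontryaginDual G) (f : C(G, ℂ)) :
    fourierFunctional m χ f = ∫ g, conj (χ g : ℂ) * f g ∂m := rfl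

variable {ι : Type*} [Fintype ι]

/-- The seminorm `y ↦ ∫ ‖∑ i, conj (χ i g) • y i‖ dm(g)`, the `L¹` norm of `∑ i, conj (χ i) ⊗ y i`. -/
noncomputable def integralSeminorm (m : Measure G) [IsFiniteMeasure m] (χ : ι → PontryaginDual G)
    (Y : Type*) [NormedAddCommGroup Y] [NormedSpace ℂ Y] : Seminorm ℂ (ι → Y) :=
  Seminorm.of (fun y => ∫ g, ‖∑ i, conj (χ i g : ℂ) • y i‖ ∂m)
    (fun x y => by
      rw [← integral_add (integrable_of_continuous (by fun_prop))
        (integrable_of_continuous (by fun_prop))]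
      refine integral_mono (integrable_of_continuous (by fun_prop))
        (integrable_of_continuous (by fun_prop)) fun g => ?_
      simp only [Pi.add_apply, smul_add, Finset.sum_add_distrib]
      exact norm_add_le _ _)
    (fun c y => by
      simp only [Pi.smul_apply, smul_comm _ c, ← Finset.smul_sum, norm_smul, integral_const_mul])

variable {m : Measure G} [IsProbabilityMeasure m]
  {χ : ι → PontryaginDual G} {X : Type*} [NormedAddCommGroup X] [NormedSpace ℂ X]

/-- For a family in `X`, the sum of Fourier coefficients is the integral over `g` of `A (∑ i, conj
(χ i g) • x i)` evaluated at `g`. Point evaluation is dominated by the norm, and `A` and `I` are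
isometric, so the seminorm bound needed for Hahn–Banach holds. -/
theorem exists_dual_extension (A : X →ₗᵢ[ℂ] C(G, ℂ)) {Y : Type*} [NormedAddCommGroup Y]
    [NormedSpace ℂ Y] (I : X →ₗᵢ[ℂ] Y) :
    ∃ Φ : (ι → Y) →ₗ[ℂ] ℂ,
      (∀ x : ι → X, Φ (fun i => I (x i)) = ∑ i, ∫ g, conj (χ i g : ℂ) * A (x i) g ∂m) ∧
      ∀ y, ‖Φ y‖ ≤ ∫ g, ‖∑ i, conj (χ i g : ℂ) • y i‖ ∂m := by
  let T : (ι → X) →ₗ[ℂ] (ι → Y) := I.toLinearMap.compLeft ι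
  have hT : Function.Injective T := fun x x' h => funext fun i => I.injective (congrFun h i)
  let ψ : (ι → X) →ₗ[ℂ] ℂ :=
    { toFun x := ∑ i, ∫ g, conj (χ i g : ℂ) * A (x i) g ∂m
      map_add' x y := by
        rw [← Finset.sum_add_distrib]
        refine Finset.sum_congr rfl fun i _ => ?_
        rw [← integral_add (integrable_of_continuous (by fun_prop))
          (integrable_of_continuous (by fun_prop))]
        simp [mul_add]
      map_smul' c x := by
        simp [Finset.mul_sum, mul_left_comm _ c, integral_const_mul] }
  let E := LinearEquiv.ofInjective T hT
  obtain ⟨Φ, hΦ, hle⟩ := Module.Dual.exists_extension_of_le_seminorm (LinearMap.range T)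
    (ψ ∘ₗ E.symm.toLinearMap) (p := integralSeminorm m χ Y) (by
      intro z
      obtain ⟨x, rfl⟩ := E.surjective z
      change ‖ψ (E.symm (E x))‖ ≤ ∫ g, ‖∑ i, conj (χ i g : ℂ) • I (x i)‖ ∂m
      rw [E.symm_apply_apply]
      change ‖∑ i, ∫ g, conj (χ i g : ℂ) * A (x i) g ∂m‖ ≤ _
      rw [← integral_finsetSum _ fun j _ => integrable_of_continuous (by fun_prop)]
      refine norm_integral_le_of_norm_le (integrable_of_continuous (by fun_prop))
        (Eventually.of_forall fun g => ?_)
      simp only [← map_smul, ← map_sum, I.norm_map]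
      rw [← A.norm_map]
      refine le_trans (le_of_eq ?_) (ContinuousMap.norm_coe_le_norm _ g)
      simp)
  refine ⟨Φ, fun x => ?_, hle⟩
  have h := hΦ (E x)
  simp only [LinearMap.comp_apply, LinearEquiv.coe_coe, E.symm_apply_apply] at h
  exact h

variable [IsTopologicalGroup G] [m.IsMulLeftInvariant]

theorem exists_projection_norm_le (hχ : Function.Injective χ) (A : X →ₗᵢ[ℂ] C(G, ℂ)) (e : ι → X)
    (he : ∀ i, A (e i) = characterMap (χ i)) (hspan : ∀ x, ∃ a : ι → ℂ, x = ∑ i, a i • e i)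
    {Y : Type*} [NormedAddCommGroup Y] [NormedSpace ℂ Y] (I : X →ₗᵢ[ℂ] Y) :
    ∃ P : Y →L[ℂ] X, (∀ x, P (I x) = x) ∧ ‖P‖ ≤ ∫ g, ‖∑ i, (χ i g : ℂ)‖ ∂m := by
  classical
  obtain ⟨Φ, hΦ, hle⟩ := exists_dual_extension (m := m) (χ := χ) A I
  let P : Y →ₗ[ℂ] X := ∑ i, (Φ ∘ₗ LinearMap.single ℂ (fun _ => Y) i).smulRight (e i)
  have hP : ∀ y, P y = ∑ i, Φ (Pi.single i y) • e i := fun y => by simp [P]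
  have hbound : ∀ y, ‖P y‖ ≤ (∫ g, ‖∑ i, (χ i g : ℂ)‖ ∂m) * ‖y‖ := by
    intro y
    rw [← A.norm_map, ContinuousMap.norm_le _ (by positivity)]
    intro g
    -- Evaluation at `g` absorbs the characters into the argument of `Φ`; the majorant then becomes
    -- a translate of `∫ ‖K‖` times `‖y‖`.
    have h1 : A (P y) g = Φ (fun i => (χ i g : ℂ) • y) := by
      have h0 : (fun i => (χ i g : ℂ) • y) = ∑ i, (χ i g : ℂ) • Pi.single i y := by
        ext j
        simp [Finset.sum_apply, Pi.single_apply]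
      rw [h0, hP]
      simp [he, mul_comm]
    rw [h1]
    refine (hle _).trans (le_of_eq ?_)
    simp only [smul_smul, ← Finset.sum_smul, norm_smul, integral_mul_const,
      norm_sum_conj_character_mul]
    rw [integral_mul_left_eq_self (fun g' => ‖∑ i, (χ i g' : ℂ)‖)]
  refine ⟨P.mkContinuous _ hbound, fun x => ?_,
    P.mkContinuous_norm_le (integral_nonneg fun _ => norm_nonneg _) _⟩
  rw [LinearMap.mkContinuous_apply, hP]
  conv_rhs => rw [← sum_integral_smul_eq (m := m) hχ A e he hspan x]
  refine Finset.sum_congr rfl fun i _ => ?_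
  congr 1
  -- The family comes from `X`, where `Φ` is known: its value is the `i`-th Fourier coefficient of
  -- `A x`.
  have h2 : (Pi.single i (I x) : ι → Y) = fun j => I ((Pi.single i x : ι → X) j) := by
    ext j
    by_cases hj : j = i
    · subst hj; simp
    · simp [hj]
  rw [h2, hΦ, Finset.sum_eq_single i]
  · simp
  · intro j _ hj
    simp [hj]
  · simp

/-! ### Lower bound by averaging over translations -/

theorem integral_conj_smul_translate (χ : PontryaginDual G) (f : C(G, ℂ)) :
    ∫ g, conj (χ g : ℂ) • translateMap f g ∂m
      = (∫ g, conj (χ g : ℂ) * f g ∂m) • characterMap χ := by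
  ext x
  rw [ContinuousMap.integral_apply (integrable_of_continuous (by fun_prop))]
  simp only [ContinuousMap.smul_apply, translateMap_apply, smul_eq_mul, characterMap_apply]
  rw [← integral_mul_const,
    ← integral_mul_left_eq_self (fun g => conj (χ g : ℂ) * f g * (χ x : ℂ)) x]
  refine integral_congr_ae (Eventually.of_forall fun g => ?_)
  have hx : conj (χ x : ℂ) * (χ x : ℂ) = 1 := by
    rw [Complex.conj_mul', Circle.norm_coe]
    norm_num
  simp only [map_mul, Circle.coe_mul]
  linear_combination (-(conj (χ g : ℂ) * f (x * g))) * hx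

/-- Averaging a projection over the translations gives the convolution with `∑ i, χ i`. -/
theorem integral_projection_translate (hχ : Function.Injective χ) (A : X →ₗᵢ[ℂ] C(G, ℂ))
    (e : ι → X) (he : ∀ i, A (e i) = characterMap (χ i))
    (hspan : ∀ x, ∃ a : ι → ℂ, x = ∑ i, a i • e i) (P : C(G, ℂ) →L[ℂ] X)
    (hP : ∀ x, P (A x) = x) (f : C(G, ℂ)) :
    ∫ g, A (P (translateMap f g)) g⁻¹ ∂m = ∫ g, conj (∑ i, (χ i g : ℂ)) * f g ∂m := by
  classical
  let μ : ι → C(G, ℂ) →L[ℂ] ℂ := fun i => fourierFunctional m (χ i) ∘L A.toContinuousLinearMap ∘L P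
  have hμ : ∀ i, μ i (characterMap (χ i)) = 1 := by
    intro i
    change fourierFunctional m (χ i) (A (P (characterMap (χ i)))) = 1
    rw [← he, hP, he, fourierFunctional_apply]
    simp only [characterMap_apply, integral_conj_character_mul, if_true]
  -- Expand in characters: the factor `χ i g⁻¹ = conj (χ i g)` moves inside the functional `μ i`,
  -- which later commutes with the integral.
  have h1 : ∀ g, A (P (translateMap f g)) g⁻¹ = ∑ i, μ i (conj (χ i g : ℂ) • translateMap f g) := by
    intro g
    conv_lhs => rw [← sum_integral_smul_eq (m := m) hχ A e he hspan (P (translateMap f g))]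
    simp only [map_sum, map_smul, he, ContinuousMap.sum_apply, ContinuousMap.smul_apply,
      characterMap_apply, ← conj_character, smul_eq_mul]
    refine Finset.sum_congr rfl fun i _ => mul_comm _ _
  have h2 : ∀ i, Integrable (fun g => conj (χ i g : ℂ) • translateMap f g) m := fun i =>
    integrable_of_continuous (by fun_prop)
  simp only [h1, map_sum, Finset.sum_mul]
  rw [integral_finsetSum _ fun i _ => (μ i).integrable_comp (h2 i),
    integral_finsetSum _ fun i _ => integrable_of_continuous (by fun_prop)]
  refine Finset.sum_congr rfl fun i _ => ?_
  rw [(μ i).integral_comp_comm (h2 i), integral_conj_smul_translate, map_smul, hμ, smul_eq_mul,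
    mul_one]

theorem norm_integral_conj_sum_mul_le (hχ : Function.Injective χ) (A : X →ₗᵢ[ℂ] C(G, ℂ))
    (e : ι → X) (he : ∀ i, A (e i) = characterMap (χ i))
    (hspan : ∀ x, ∃ a : ι → ℂ, x = ∑ i, a i • e i) (P : C(G, ℂ) →L[ℂ] X)
    (hP : ∀ x, P (A x) = x) (f : C(G, ℂ)) :
    ‖∫ g, conj (∑ i, (χ i g : ℂ)) * f g ∂m‖ ≤ ‖P‖ * ‖f‖ := by
  rw [← integral_projection_translate hχ A e he hspan P hP f]
  refine (norm_integral_le_of_norm_le_const (C := ‖P‖ * ‖f‖)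
    (Eventually.of_forall fun g => ?_)).trans (by simp)
  calc ‖A (P (translateMap f g)) g⁻¹‖ ≤ ‖A (P (translateMap f g))‖ := ContinuousMap.norm_coe_le_norm _ _
    _ = ‖P (translateMap f g)‖ := A.norm_map _
    _ ≤ ‖P‖ * ‖translateMap f g‖ := P.le_opNorm _
    _ ≤ ‖P‖ * ‖f‖ := by gcongr; exact norm_translateMap_le f g

theorem integral_norm_sum_character_le (hχ : Function.Injective χ) (A : X →ₗᵢ[ℂ] C(G, ℂ))
    (e : ι → X) (he : ∀ i, A (e i) = characterMap (χ i))
    (hspan : ∀ x, ∃ a : ι → ℂ, x = ∑ i, a i • e i) (P : C(G, ℂ) →L[ℂ] X)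
    (hP : ∀ x, P (A x) = x) :
    ∫ g, ‖∑ i, (χ i g : ℂ)‖ ∂m ≤ ‖P‖ := by
  refine le_of_forall_pos_le_add fun ε hε => ?_
  let K : C(G, ℂ) := ∑ i, characterMap (χ i)
  have hK : ∀ g, K g = ∑ i, (χ i g : ℂ) := fun g => by simp [K, ContinuousMap.sum_apply]
  simp only [← hK]
  have hpos : ∀ g, 0 < ‖K g‖ + ε := fun g => by positivity
  -- A continuous substitute for the phase `K / ‖K‖`, which is undefined at zeros of `K`.
  let f : C(G, ℂ) := ⟨fun g => K g * (((‖K g‖ + ε)⁻¹ : ℝ) : ℂ), by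
    refine K.continuous.mul (Complex.continuous_ofReal.comp ?_)
    exact Continuous.inv₀ (by fun_prop) fun g => (hpos g).ne'⟩
  have hf : ‖f‖ ≤ 1 := by
    refine (ContinuousMap.norm_le _ zero_le_one).2 fun g => ?_
    change ‖K g * (((‖K g‖ + ε)⁻¹ : ℝ) : ℂ)‖ ≤ 1
    rw [norm_mul, Complex.norm_real, Real.norm_of_nonneg (inv_nonneg.2 (hpos g).le),
      ← div_eq_mul_inv, div_le_one (hpos g)]
    linarith
  have hKf : ∀ g, conj (K g) * f g = ((‖K g‖ ^ 2 / (‖K g‖ + ε) : ℝ) : ℂ) := by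
    intro g
    change conj (K g) * (K g * (((‖K g‖ + ε)⁻¹ : ℝ) : ℂ)) = _
    rw [← mul_assoc, Complex.conj_mul', div_eq_mul_inv]
    push_cast
    ring
  have h1 := norm_integral_conj_sum_mul_le (m := m) hχ A e he hspan P hP f
  simp only [← hK, hKf] at h1
  rw [integral_complex_ofReal, Complex.norm_real] at h1
  have h2 : ∫ g, (‖K g‖ - ε) ∂m ≤ ∫ g, ‖K g‖ ^ 2 / (‖K g‖ + ε) ∂m := by
    refine integral_mono (integrable_of_continuous (by fun_prop)) (integrable_of_continuous
      (Continuous.div (by fun_prop) (by fun_prop) fun g => (hpos g).ne')) fun g => ?_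
    change ‖K g‖ - ε ≤ ‖K g‖ ^ 2 / (‖K g‖ + ε)
    rw [le_div_iff₀ (hpos g)]
    -- `(‖K g‖ - ε) * (‖K g‖ + ε) = ‖K g‖ ^ 2 - ε ^ 2`.
    nlinarith [sq_nonneg ε]
  rw [integral_sub (integrable_of_continuous (by fun_prop)) (integrable_const ε)] at h2
  simp only [integral_const, probReal_univ, one_smul] at h2
  have h3 : ‖P‖ * ‖f‖ ≤ ‖P‖ := mul_le_of_le_one_right (norm_nonneg P) hf
  linarith [le_abs_self (∫ g, ‖K g‖ ^ 2 / (‖K g‖ + ε) ∂m), Real.norm_eq_abs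
    (∫ g, ‖K g‖ ^ 2 / (‖K g‖ + ε) ∂m)]

end Projections

/-! ### Restriction along a map with dense range -/

section DenseRange

variable {S T : Type*} [TopologicalSpace S] [CompactSpace S]

theorem ContinuousMap.norm_eq_iSup_of_denseRange (f : C(S, ℂ)) {β : T → S} (hβ : DenseRange β)
    [Nonempty T] : ‖f‖ = ⨆ t, ‖f (β t)‖ := by
  have hb : BddAbove (Set.range fun t => ‖f (β t)‖) :=
    ⟨‖f‖, by rintro _ ⟨t, rfl⟩; exact f.norm_coe_le_norm _⟩
  refine le_antisymm ?_ (ciSup_le fun t => f.norm_coe_le_norm _)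
  refine (ContinuousMap.norm_le _ (Real.iSup_nonneg fun t => norm_nonneg _)).2 fun x => ?_
  exact hβ.induction_on (p := fun x => ‖f x‖ ≤ ⨆ t, ‖f (β t)‖) x
    (isClosed_le (by fun_prop) continuous_const) fun t => le_ciSup hb t

variable [TopologicalSpace T]

/-- Restriction of continuous functions along a continuous map with dense range. -/
noncomputable def restrictIsometry (β : C(T, S)) (hβ : DenseRange β) [Nonempty T] :
    C(S, ℂ) →ₗᵢ[ℂ] (T →ᵇ ℂ) where
  toFun f := (BoundedContinuousFunction.mkOfCompact f).compContinuous β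
  map_add' _ _ := rfl
  map_smul' _ _ := rfl
  norm_map' f := by
    rw [BoundedContinuousFunction.norm_eq_iSup_norm, f.norm_eq_iSup_of_denseRange hβ]
    rfl

end DenseRange

/-! ### The Bohr lift -/

section DirichletPolynomials

variable {ω : ℕ → ℝ} {J : Finset ℕ} {G : Type u} [CommGroup G] [TopologicalSpace G]
  {β : Multiplicative ℝ →ₜ* G} {h : ℕ → PontryaginDual G}

theorem IsDirichletGroup.continuousMap_ext (hβ : IsDirichletGroup β) {f f' : C(G, ℂ)}
    (hff' : ∀ t : ℝ, f (β (Multiplicative.ofAdd t)) = f' (β (Multiplicative.ofAdd t))) : f = f' :=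
  ContinuousMap.ext <| congrFun <| hβ.equalizer f.continuous f'.continuous (funext hff')

theorem HInf.exists_coeff (D : HInf ω J) :
    ∃ a : ℕ → ℂ, ∀ s, D.toFun s = ∑ n ∈ J, a n * Complex.exp (-(ω n : ℂ) * s) := D.2

theorem HInf.ext_toFun {D E : HInf ω J} (hDE : ∀ s, D.toFun s = E.toFun s) : D = E :=
  Subtype.ext (funext hDE)

/-- The Bohr lift of a Dirichlet polynomial to a function on the group `G`. -/
noncomputable def bohrLift (h : ℕ → PontryaginDual G) (D : HInf ω J) : C(G, ℂ) :=
  ∑ n ∈ J, D.exists_coeff.choose n • characterMap (h n)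

theorem character_apply_eq_exp (hh : ∀ n, IsCharacterOver β (ω n) (h n)) (n : ℕ) (t : ℝ) :
    (h n (β (Multiplicative.ofAdd t)) : ℂ)
      = Complex.exp (-(ω n : ℂ) * (t * Complex.I)) := by
  rw [hh, Circle.coe_exp]
  congr 1
  push_cast
  ring

theorem bohrLift_apply (hh : ∀ n, IsCharacterOver β (ω n) (h n)) (D : HInf ω J) (t : ℝ) :
    bohrLift h D (β (Multiplicative.ofAdd t)) = D.toFun (t * Complex.I) := by
  rw [D.exists_coeff.choose_spec]
  simp [bohrLift, ContinuousMap.sum_apply, character_apply_eq_exp hh]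

theorem character_injective (hω : IsFrequency ω) (hh : ∀ n, IsCharacterOver β (ω n) (h n)) :
    Function.Injective h := by
  intro n k hnk
  have h1 : ∀ t : ℝ, Circle.exp (-(ω n * t)) = Circle.exp (-(ω k * t)) := fun t => by
    rw [← hh n t, ← hh k t, hnk]
  by_contra hne
  have hd : ω n - ω k ≠ 0 := sub_ne_zero.2 (hω.strictMono.injective.ne hne)
  -- At this time the two exponentials differ by the factor `-1`.
  have h2 := h1 (Real.pi / (ω n - ω k))
  have h3 : Circle.exp (-(ω k * (Real.pi / (ω n - ω k))) - -(ω n * (Real.pi / (ω n - ω k)))) = 1 := by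
    rw [Circle.exp_sub, h2, div_self']
  rw [show -(ω k * (Real.pi / (ω n - ω k))) - -(ω n * (Real.pi / (ω n - ω k))) = Real.pi by
    field_simp; ring] at h3
  have h4 := congrArg (fun z : Circle => (z : ℂ)) h3
  simp only [Circle.coe_exp, Complex.exp_pi_mul_I, Circle.coe_one] at h4
  norm_num at h4

variable [CompactSpace G]

/-- The Bohr lift is a linear isometry. -/
noncomputable def bohrLiftIsometry (hβ : IsDirichletGroup β)
    (hh : ∀ n, IsCharacterOver β (ω n) (h n)) : HInf ω J →ₗᵢ[ℂ] C(G, ℂ) where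
  toFun := bohrLift h
  map_add' D E := hβ.continuousMap_ext fun t => by
    rw [ContinuousMap.add_apply, bohrLift_apply hh, bohrLift_apply hh, bohrLift_apply hh]
    rfl
  map_smul' c D := hβ.continuousMap_ext fun t => by
    rw [ContinuousMap.smul_apply, bohrLift_apply hh, bohrLift_apply hh]
    rfl
  norm_map' D := by
    change ‖bohrLift h D‖ = _
    rw [ContinuousMap.norm_eq_iSup_of_denseRange _ hβ, HInf.norm_def]
    exact congrArg iSup (funext fun t : ℝ => congrArg norm (bohrLift_apply hh D t))

variable (ω) in
/-- The Dirichlet monomial `s ↦ e^{-ω_n s}`. -/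
noncomputable def dirichletMonomial (n : J) : HInf ω J :=
  ⟨fun s => Complex.exp (-(ω n : ℂ) * s), Pi.single (n : ℕ) 1, fun s => by
    simp [Pi.single_apply, ite_mul]⟩

theorem toFun_sum_smul_dirichletMonomial (a : J → ℂ) (s : ℂ) :
    (∑ n, a n • dirichletMonomial ω n).toFun s
      = ∑ n, a n * Complex.exp (-(ω n : ℂ) * s) := by
  let ev : HInf ω J →ₗ[ℂ] ℂ :=
    { toFun D := D.toFun s, map_add' _ _ := rfl, map_smul' _ _ := rfl }
  change ev _ = _
  rw [map_sum]
  rfl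

theorem exists_eq_sum_dirichletMonomial (D : HInf ω J) :
    ∃ a : J → ℂ, D = ∑ n, a n • dirichletMonomial ω n := by
  obtain ⟨a, ha⟩ := D.exists_coeff
  refine ⟨fun n => a n, HInf.ext_toFun fun s => ?_⟩
  rw [ha, toFun_sum_smul_dirichletMonomial,
    Finset.sum_coe_sort J fun n => a n * Complex.exp (-(ω n : ℂ) * s)]

theorem bohrLiftIsometry_dirichletMonomial (hβ : IsDirichletGroup β)
    (hh : ∀ n, IsCharacterOver β (ω n) (h n)) (n : J) :
    bohrLiftIsometry hβ hh (dirichletMonomial ω n) = characterMap (h n) :=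
  hβ.continuousMap_ext fun t => (bohrLift_apply hh (dirichletMonomial ω n) t).trans
    (character_apply_eq_exp hh n t).symm

end DirichletPolynomials

/-! ### Transfer to projection constants -/

theorem closedComplemented_range {X Y : Type*} [NormedAddCommGroup X] [NormedSpace ℂ X]
    [NormedAddCommGroup Y] [NormedSpace ℂ Y] (I : X →ₗᵢ[ℂ] Y) {P : Y →L[ℂ] X}
    (hP : ∀ x, P (I x) = x) : (LinearMap.range I.toLinearMap).ClosedComplemented :=
  ⟨I.equivRange.toLinearIsometry.toContinuousLinearMap ∘L P, by
    rintro ⟨_, x, rfl⟩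
    exact congrArg I.equivRange (hP x)⟩

theorem relProjectionConstant_range_le {X Y : Type*} [NormedAddCommGroup X] [NormedSpace ℂ X]
    [NormedAddCommGroup Y] [NormedSpace ℂ Y] (I : X →ₗᵢ[ℂ] Y) {P : Y →L[ℂ] X}
    (hP : ∀ x, P (I x) = x) :
    relProjectionConstant (LinearMap.range I.toLinearMap) ≤ ENNReal.ofReal ‖P‖ := by
  refine iInf₂_le_of_le (I.equivRange.toLinearIsometry.toContinuousLinearMap ∘L P) ?_ ?_
  · rintro ⟨_, x, rfl⟩
    exact congrArg I.equivRange (hP x)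
  · refine ENNReal.ofReal_le_ofReal (ContinuousLinearMap.opNorm_le_bound _ (norm_nonneg _) ?_)
    intro y
    exact (I.equivRange.norm_map (P y)).trans_le (P.le_opNorm y)

theorem theorem2p5 (ω : ℕ → ℝ) (hω : IsFrequency ω) (J : Finset ℕ)
    (G : Type u) [CommGroup G] [TopologicalSpace G] [IsTopologicalGroup G] [CompactSpace G]
    [MeasurableSpace G] [BorelSpace G]
    (m : Measure G) [m.IsHaarMeasure] [IsProbabilityMeasure m]
    (β : Multiplicative ℝ →ₜ* G) (hβ : IsOmegaDirichletGroup ω β)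
    (h : ℕ → PontryaginDual G) (hh : ∀ n, IsCharacterOver β (ω n) (h n)) :
    projectionConstant.{0, v} (HInf ω J)
      = ENNReal.ofReal (∫ g, ‖∑ n ∈ J, (h n g : ℂ)‖ ∂m) := by
  let χ : J → PontryaginDual G := fun n => h n
  have hχ : Function.Injective χ := (character_injective hω hh).comp Subtype.val_injective
  have hsum : ∀ g, ∑ n ∈ J, (h n g : ℂ) = ∑ n, (χ n g : ℂ) := fun g =>
    (Finset.sum_coe_sort J fun n => (h n g : ℂ)).symm
  simp only [hsum]
  let A : HInf ω J →ₗᵢ[ℂ] C(G, ℂ) := bohrLiftIsometry hβ.isDirichletGroup hh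
  have he : ∀ n, A (dirichletMonomial ω n) = characterMap (χ n) :=
    bohrLiftIsometry_dirichletMonomial hβ.isDirichletGroup hh
  refine le_antisymm ?_ ?_
  · refine iSup_le fun Y => iSup_le fun _ => iSup_le fun _ => iSup_le fun _ => iSup_le fun I =>
      iSup_le fun _ => ?_
    obtain ⟨P, hP, hle⟩ := exists_projection_norm_le (m := m) hχ A _ he
      exists_eq_sum_dirichletMonomial I
    exact (relProjectionConstant_range_le I hP).trans (ENNReal.ofReal_le_ofReal hle)
  -- The test space must live in universe `v`, while `G` lives in `u`. Bounded functions on `ℝ`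
  -- contain `C(G, ℂ)` isometrically through `β` and can be lifted to any universe.
  · let R : C(G, ℂ) →ₗᵢ[ℂ] ULift.{v} (Multiplicative ℝ →ᵇ ℂ) :=
      (LinearIsometryEquiv.ulift ℂ _).symm.toLinearIsometry.comp
        (restrictIsometry (β : C(Multiplicative ℝ, G)) hβ.isDirichletGroup)
    let I := R.comp A
    -- Only the existence of `P₀` matters here: it makes the range of `I` complemented.
    obtain ⟨P₀, hP₀, -⟩ := exists_projection_norm_le (m := m) hχ A _ he
      exists_eq_sum_dirichletMonomial I
    refine le_iSup_of_le (ULift.{v} (Multiplicative ℝ →ᵇ ℂ)) <| le_iSup_of_le inferInstance <|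
      le_iSup_of_le inferInstance <| le_iSup_of_le inferInstance <| le_iSup_of_le I <|
      le_iSup_of_le (closedComplemented_range I hP₀) <| le_iInf₂ fun P hP => ?_
    -- Composing `P` with `R` and with the inverse of `I` on its range gives a projection from `C(G,
    -- ℂ)` of norm at most `‖P‖`.
    let E := I.equivRange.symm.toLinearIsometry.toContinuousLinearMap
    have hQ : ∀ x, (E ∘L P ∘L R.toContinuousLinearMap) (A x) = x := by
      intro x
      change I.equivRange.symm (P (I x)) = x
      rw [LinearIsometryEquiv.symm_apply_eq]
      exact hP (I.equivRange x)
    refine ENNReal.ofReal_le_ofReal ((integral_norm_sum_character_le hχ A _ he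
      exists_eq_sum_dirichletMonomial _ hQ).trans ?_)
    refine ContinuousLinearMap.opNorm_le_bound _ (ContinuousLinearMap.opNorm_nonneg P) fun f => ?_
    calc ‖I.equivRange.symm (P (R f))‖ = ‖P (R f)‖ := LinearIsometryEquiv.norm_map _ _
      _ ≤ ‖P‖ * ‖R f‖ := P.le_opNorm _
      _ = ‖P‖ * ‖f‖ := by rw [R.norm_map]
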